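/- For $g\colon\mathbb R\to\mathbb R$ or $g\colon\mathbb R\to\mathbb C$ let $\operatorname{Var}(g)=\sup_{\phi}\sum_{m\in\mathbb Z}|g(\phi(m+1))-g(\phi(m))|\in[0,\infty]$ denote the total variation of $g$, the supremum being over all monotone $\phi\colon\mathbb Z\to\mathbb R$. Let $\mathrm{BV}(\mathbb R)$ be the set of functions $f\colon\mathbb R\to\mathbb C$ with $\operatorname{Var}(f)<\infty$; for such $f$ the limits $f(\pm\infty)=\lim_{x\to\pm\infty}f(x)$ exist. Let $Mf(x)=\sup_{r>0}\frac1{2r}\int_{x-r}^{x+r}|f|$, $x\in\mathbb R$, be the centered Hardy--Littlewood maximal function of $f$. Call $f\in\mathrm{BV}(\mathbb R)$ simple if there are $a,b\in\mathbb C$ and $N\in\{1,2,\dots\}$ such that $f(-x)=a$ and $f(x)=b$ for all real $x>N$, and $f$ is constant on each interval $[n-\frac12,n+\frac12)$, $n\in\mathbb Z$. Proposition. If the inequality $$\operatorname{Var}(Mf)\le\operatorname{Var}(f)-\tfrac12\big||f(\infty)|-|f(-\infty)|\big|$$ holds for every simple $f\in\mathrm{BV}(\mathbb R)$ with values in $[0,\infty)$,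 then it holds for every $f\in\mathrm{BV}(\mathbb R)$. -/

import Mathlib

open Set Filter Topology MeasureTheory
open scoped ENNReal

noncomputable section

namespace CenteredMaximal

/-- The total variation over `ℝ`, as an extended nonnegative number: the supremum of
`∑ |g (φ (m + 1)) - g (φ m)|` over finite stretches of monotone sequences `φ` of reals. -/
def totalVar {E : Type*} [PseudoEMetricSpace E] (g : ℝ → E) : ℝ≥0∞ :=
  eVariationOn g univ

/-- `f ∈ BV(ℝ)`: the total variation of `f : ℝ → ℂ` is finite. -/
def IsBV (f : ℝ → ℂ) : Prop :=
  totalVar f ≠ ∞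

/-- `f(∞)`, the limit of `f` at `+∞` (it exists for `f ∈ BV(ℝ)`, see `IsBV.tendsto_limPos`). -/
def limPos (f : ℝ → ℂ) : ℂ :=
  limUnder atTop f

/-- `f(-∞)`, the limit of `f` at `-∞` (it exists for `f ∈ BV(ℝ)`, see `IsBV.tendsto_limNeg`). -/
def limNeg (f : ℝ → ℂ) : ℂ :=
  limUnder atBot f

/-- The centered Hardy–Littlewood maximal function
`Mf(x) = sup_{r > 0} (1 / (2 r)) ∫_{x - r}^{x + r} |f|`.
For `f ∈ BV(ℝ)` it is a supremum of a bounded set of averages of an integrable function,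
see `IsBV.intervalIntegrable_norm` and `IsBV.bddAbove_averages`. -/
def maximalFn (f : ℝ → ℂ) (x : ℝ) : ℝ :=
  ⨆ r : {r : ℝ // 0 < r}, (1 / (2 * (r : ℝ))) * ∫ t in (x - r)..(x + r), ‖f t‖

/-- The inequality `Var(Mf) ≤ Var(f) - ½ ||f(∞)| - |f(-∞)||`. The subtracted (finite, nonnegative)
number is written on the left, so that no truncated subtraction occurs; for `f ∈ BV(ℝ)` the
right-hand side is finite, so that finiteness of `Var(Mf)` is part of the claim. -/
def VarIneq (f : ℝ → ℂ) : Prop :=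
  totalVar (maximalFn f) + ENNReal.ofReal ((1 / 2) * |‖limPos f‖ - ‖limNeg f‖|) ≤ totalVar f

/-- `f ∈ BV(ℝ)` is simple: it is constant near `-∞`, constant near `+∞`, and constant on each
interval `[n - 1/2, n + 1/2)`, `n ∈ ℤ`. -/
def IsSimple (f : ℝ → ℂ) : Prop :=
  IsBV f ∧
  (∃ (a b : ℂ) (N : ℕ), 1 ≤ N ∧ ∀ x : ℝ, (N : ℝ) < x → f (-x) = a ∧ f x = b) ∧
  ∀ n : ℤ, ∀ x ∈ Ico ((n : ℝ) - 1 / 2) ((n : ℝ) + 1 / 2),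
    ∀ y ∈ Ico ((n : ℝ) - 1 / 2) ((n : ℝ) + 1 / 2), f x = f y

/-- `f` takes only nonnegative real values. -/
def IsNonneg (f : ℝ → ℂ) : Prop :=
  ∀ x : ℝ, ∃ c : ℝ, 0 ≤ c ∧ f x = (c : ℂ)

theorem IsBV.tendsto_limPos {f : ℝ → ℂ} (hf : IsBV f) : Tendsto f atTop (𝓝 (limPos f)) :=
  BoundedVariationOn.tendsto_atTop_limUnder hf

theorem IsBV.tendsto_limNeg {f : ℝ → ℂ} (hf : IsBV f) : Tendsto f atBot (𝓝 (limNeg f)) :=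
  BoundedVariationOn.tendsto_atBot_limUnder hf

theorem IsBV.norm_le {f : ℝ → ℂ} (hf : IsBV f) (x : ℝ) :
    ‖f x‖ ≤ ‖f 0‖ + (totalVar f).toReal := by
  have h := BoundedVariationOn.dist_le hf (mem_univ x) (mem_univ (0 : ℝ))
  have h2 : ‖f x‖ ≤ ‖f 0‖ + dist (f x) (f 0) := by
    rw [dist_eq_norm]
    calc ‖f x‖ = ‖f 0 + (f x - f 0)‖ := by congr 1; ring
      _ ≤ _ := norm_add_le _ _
  exact h2.trans (add_le_add le_rfl h)

theorem IsBV.bddAbove_averages {f : ℝ → ℂ} (hf : IsBV f) (x : ℝ) :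
    BddAbove (range fun r : {r : ℝ // 0 < r} =>
      (1 / (2 * (r : ℝ))) * ∫ t in (x - r)..(x + r), ‖f t‖) := by
  refine ⟨‖f 0‖ + (totalVar f).toReal, ?_⟩
  rintro _ ⟨⟨r, hr⟩, rfl⟩
  have h := intervalIntegral.norm_integral_le_of_norm_le_const (a := x - r) (b := x + r)
    (f := fun t => ‖f t‖) (C := ‖f 0‖ + (totalVar f).toReal)
    (fun t _ => by simpa using hf.norm_le t)
  have h1 : |x + r - (x - r)| = 2 * r := by
    rw [show x + r - (x - r) = 2 * r by ring, abs_of_pos (by positivity)]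
  rw [h1] at h
  have h2 := (le_abs_self _).trans h
  simp only
  rw [one_div, inv_mul_le_iff₀ (by positivity)]
  linarith

theorem IsBV.intervalIntegrable_norm {f : ℝ → ℂ} (hf : IsBV f) (a b : ℝ) :
    IntervalIntegrable (fun t => ‖f t‖) volume a b := by
  have hn : LocallyBoundedVariationOn (fun t => ‖f t‖) univ :=
    (LipschitzWith.comp_boundedVariationOn lipschitzWith_one_norm hf).locallyBoundedVariationOn
  obtain ⟨p, q, hp, hq, hpq⟩ := hn.exists_monotoneOn_sub_monotoneOn
  rw [hpq]
  exact ((hp.mono (subset_univ _)).intervalIntegrable).sub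
    ((hq.mono (subset_univ _)).intervalIntegrable)

end CenteredMaximal

end

namespace CenteredMaximal

/-! Let `f_n(t) = f (grid n (n * t))`, which samples `f` at the multiples of `1/n` in `[-n, n]`.
After dilation by `n`, the norm of `f_n` is simple and nonnegative, so the hypothesis applies to it.
Dilations commute with `M` and preserve variation; norms and monotone reparametrizations do not
increase variation. Hence `Var(M f_n) + ½ ||f(n)| - |f(-n)|| ≤ Var(f)`.

As `n → ∞`, variation is lower semicontinuous under pointwise convergence, and `M f_n → M f`
wherever `f` is continuous (`IsBV.tendsto_maximalFn_grid`). Such points suffice: they are dense, and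
`M f` is continuous from at least one side everywhere (`IsBV.tendsto_maximalFn_left_or_right`), so
its variation is already attained on them (`IsBV.totalVar_maximalFn_le`). -/

/-! ### Averages, dilations and reflections of the maximal function -/

/-- The average of `‖f‖` over `[x - r, x + r]`. -/
noncomputable def avg (f : ℝ → ℂ) (x r : ℝ) : ℝ :=
  (1 / (2 * r)) * ∫ t in (x - r)..(x + r), ‖f t‖

theorem IsBV.avg_le_maximalFn {f : ℝ → ℂ} (hf : IsBV f) (x : ℝ) {r : ℝ} (hr : 0 < r) :
    avg f x r ≤ maximalFn f x :=
  le_ciSup (hf.bddAbove_averages x) ⟨r, hr⟩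

theorem maximalFn_le {f : ℝ → ℂ} {x C : ℝ} (h : ∀ r, 0 < r → avg f x r ≤ C) :
    maximalFn f x ≤ C :=
  haveI : Nonempty {r : ℝ // 0 < r} := ⟨⟨1, one_pos⟩⟩
  ciSup_le fun r => h r r.2

theorem abs_maximalFn_sub_le {f g : ℝ → ℂ} (hf : IsBV f) (hg : IsBV g) {x y ε : ℝ}
    (h : ∀ r, 0 < r → |avg f x r - avg g y r| ≤ ε) :
    |maximalFn f x - maximalFn g y| ≤ ε := by
  rw [abs_le]
  have h1 : maximalFn f x ≤ maximalFn g y + ε := maximalFn_le fun r hr => by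
    linarith [(abs_le.1 (h r hr)).2, hg.avg_le_maximalFn y hr]
  have h2 : maximalFn g y ≤ maximalFn f x + ε := maximalFn_le fun r hr => by
    linarith [(abs_le.1 (h r hr)).1, hf.avg_le_maximalFn x hr]
  constructor <;> linarith

theorem maximalFn_norm (f : ℝ → ℂ) : maximalFn (fun x => (‖f x‖ : ℂ)) = maximalFn f := by
  funext x
  simp [maximalFn]

theorem maximalFn_comp_mul_left (g : ℝ → ℂ) {c : ℝ} (hc : 0 < c) (x : ℝ) :
    maximalFn (fun t => g (c * t)) x = maximalFn g (c * x) := by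
  unfold maximalFn
  refine Function.Surjective.iSup_congr
    (fun r : {r : ℝ // 0 < r} => (⟨c * r, mul_pos hc r.2⟩ : {r : ℝ // 0 < r})) ?_ ?_
  · rintro ⟨r, hr⟩
    refine ⟨⟨r / c, div_pos hr hc⟩, ?_⟩
    ext
    simp only
    field_simp
  · rintro ⟨r, hr⟩
    simp only
    rw [intervalIntegral.integral_comp_mul_left (fun t => ‖g t‖) hc.ne', smul_eq_mul,
      mul_sub, mul_add]
    field_simp

theorem maximalFn_comp_neg (g : ℝ → ℂ) (x : ℝ) :
    maximalFn (fun t => g (-t)) x = maximalFn g (-x) := by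
  unfold maximalFn
  congr 1
  funext r
  rw [intervalIntegral.integral_comp_neg (fun t => ‖g t‖)]
  congr 2 <;> ring

theorem IsBV.comp_neg {f : ℝ → ℂ} (hf : IsBV f) : IsBV fun t => f (-t) := by
  refine ne_top_of_le_ne_top hf ?_
  exact eVariationOn.comp_le_of_antitoneOn f (fun t => -t) (t := univ)
    (fun _ _ _ _ h => neg_le_neg h) (mapsTo_univ _ _)

/-! ### Total variation under composition and on approximating sets -/

theorem totalVar_comp_le {E : Type*} [PseudoEMetricSpace E] (g : ℝ → E) {φ : ℝ → ℝ}
    (hφ : Monotone φ) : totalVar (fun x => g (φ x)) ≤ totalVar g :=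
  eVariationOn.comp_le_of_monotoneOn g φ (hφ.monotoneOn _) (mapsTo_univ _ _)

theorem totalVar_norm_le (f : ℝ → ℂ) : totalVar (fun x => (‖f x‖ : ℂ)) ≤ totalVar f := by
  refine (LipschitzOnWith.comp_eVariationOn_le (C := 1) (t := univ) (g := f)
    (f := fun z : ℂ => (‖z‖ : ℂ)) ?_ (mapsTo_univ _ _)).trans (by simp [totalVar])
  refine (LipschitzWith.of_dist_le_mul fun x y => ?_).lipschitzOnWith
  rw [dist_eq_norm, ← Complex.ofReal_sub, Complex.norm_real, NNReal.coe_one, one_mul,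
    dist_eq_norm]
  exact abs_norm_sub_norm_le x y

/-- The variation of `g` is computed on any set `D` from which every value of `g` can be
approximated locally. -/
theorem totalVar_le_eVariationOn {E : Type*} [PseudoMetricSpace E] {g : ℝ → E} {D : Set ℝ}
    (h : ∀ x : ℝ, ∀ ε > 0, ∃ y ∈ D, |y - x| < ε ∧ dist (g y) (g x) < ε) :
    totalVar g ≤ eVariationOn g D := by
  choose φ hD hx hg using fun (n : ℕ) (x : ℝ) => h x (1 / ((n : ℝ) + 1)) Nat.one_div_pos_of_nat
  have hφ : ∀ x, Tendsto (fun n => φ n x) atTop (𝓝 x) := fun x => by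
    rw [tendsto_iff_dist_tendsto_zero]
    exact squeeze_zero (fun _ => dist_nonneg) (fun n => (hx n x).le)
      tendsto_one_div_add_atTop_nhds_zero_nat
  have hgφ : ∀ x, Tendsto (fun n => g (φ n x)) atTop (𝓝 (g x)) := fun x => by
    rw [tendsto_iff_dist_tendsto_zero]
    exact squeeze_zero (fun _ => dist_nonneg) (fun n => (hg n x).le)
      tendsto_one_div_add_atTop_nhds_zero_nat
  refine iSup_le ?_
  rintro ⟨m, u, hu, -⟩
  set S : Set ℝ := u '' Iic m with hS
  have hfin : S.Finite := (finite_Iic m).image u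
  refine (eVariationOn.sum_le_of_monotoneOn_Iic (s := S) (hu.monotoneOn _)
    (fun i hi => mem_image_of_mem u hi)).trans ?_
  -- Strict inequalities between points of the finite set `S` survive small perturbations, so `φ n`
  -- is eventually monotone on `S`.
  have hmono : ∀ᶠ n in atTop, MonotoneOn (φ n) S := by
    have : ∀ᶠ n in atTop, ∀ a ∈ S, ∀ b ∈ S, a ≤ b → φ n a ≤ φ n b := by
      refine (hfin.eventually_all).2 fun a _ => (hfin.eventually_all).2 fun b _ => ?_
      rcases lt_trichotomy a b with hab | rfl | hab
      · filter_upwards [(hφ a).eventually_lt (hφ b) hab] with n hn _ using hn.le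
      · simp
      · exact Eventually.of_forall fun n hn => absurd hn hab.not_ge
    filter_upwards [this] with n hn a ha b hb hab using hn a ha b hb hab
  refine le_of_forall_lt fun v hv => ?_
  have h1 := eVariationOn.lowerSemicontinuous_aux (F := fun n x => g (φ n x)) (p := atTop)
    (s := S) (fun x _ => hgφ x) hv
  obtain ⟨n, hn1, hn2⟩ := (h1.and hmono).exists
  exact hn1.trans_le (eVariationOn.comp_le_of_monotoneOn g (φ n) hn2 fun x _ => hD n x)

/-! ### One-sided continuity of the maximal function -/

theorem IsBV.ae_continuousAt {f : ℝ → ℂ} (hf : IsBV f) : ∀ᵐ x, ContinuousAt f x := by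
  have h : LocallyBoundedVariationOn f univ := BoundedVariationOn.locallyBoundedVariationOn hf
  filter_upwards [h.ae_differentiableAt] with x hx using hx.continuousAt

theorem IsBV.integral_norm_le {f : ℝ → ℂ} (hf : IsBV f) {a b c : ℝ} (hab : a ≤ b)
    (h : ∀ t ∈ Ioo a b, ‖f t‖ ≤ c) : ∫ t in a..b, ‖f t‖ ≤ (b - a) * c := by
  have := intervalIntegral.integral_mono_on_of_le_Ioo hab (hf.intervalIntegrable_norm a b)
    (intervalIntegrable_const (c := c)) h
  simpa using this

theorem IsBV.le_integral_norm {f : ℝ → ℂ} (hf : IsBV f) {a b c : ℝ} (hab : a ≤ b)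
    (h : ∀ t ∈ Ioo a b, c ≤ ‖f t‖) : (b - a) * c ≤ ∫ t in a..b, ‖f t‖ := by
  have := intervalIntegral.integral_mono_on_of_le_Ioo hab
    (intervalIntegrable_const (c := c)) (hf.intervalIntegrable_norm a b) h
  simpa using this

theorem IsBV.abs_avg_sub_avg_le {f : ℝ → ℂ} (hf : IsBV f) {C : ℝ} (hC : ∀ t, ‖f t‖ ≤ C)
    (x y : ℝ) {r : ℝ} (hr : 0 < r) : |avg f y r - avg f x r| ≤ C * |y - x| / r := by
  have hi := hf.intervalIntegrable_norm
  have hb : ∀ a b : ℝ, |∫ t in a..b, ‖f t‖| ≤ C * |b - a| := fun a b => by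
    rw [← Real.norm_eq_abs]
    exact intervalIntegral.norm_integral_le_of_norm_le_const fun t _ => by
      rw [norm_norm]; exact hC t
  have h1 := hb (y - r) (x - r)
  have h2 := hb (y + r) (x + r)
  have h3 : avg f y r - avg f x r =
      (1 / (2 * r)) * ((∫ t in (y - r)..(x - r), ‖f t‖) - ∫ t in (y + r)..(x + r), ‖f t‖) := by
    rw [avg, avg, ← mul_sub, intervalIntegral.integral_interval_sub_interval_comm
      (hi _ _) (hi _ _) (hi _ _)]
  have e1 : |x - r - (y - r)| = |y - x| := by rw [abs_sub_comm y x]; congr 1; ring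
  have e2 : |x + r - (y + r)| = |y - x| := by rw [abs_sub_comm y x]; congr 1; ring
  rw [e1] at h1
  rw [e2] at h2
  rw [h3, abs_mul, abs_of_pos (by positivity : 0 < 1 / (2 * r))]
  calc (1 / (2 * r)) * |(∫ t in (y - r)..(x - r), ‖f t‖) - ∫ t in (y + r)..(x + r), ‖f t‖|
      ≤ (1 / (2 * r)) * (C * |y - x| + C * |y - x|) := by
        gcongr
        exact (abs_sub _ _).trans (add_le_add h1 h2)
    _ = C * |y - x| / r := by field_simp; ring

theorem IsBV.lowerSemicontinuous_maximalFn {f : ℝ → ℂ} (hf : IsBV f) :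
    LowerSemicontinuous (maximalFn f) := by
  intro x v hv
  have : Nonempty {r : ℝ // 0 < r} := ⟨⟨1, one_pos⟩⟩
  obtain ⟨⟨r, hr⟩, hvr⟩ := exists_lt_of_lt_ciSup hv
  change v < avg f x r at hvr
  have h1 : Tendsto (fun y => avg f y r) (𝓝 x) (𝓝 (avg f x r)) := by
    rw [tendsto_iff_dist_tendsto_zero]
    refine squeeze_zero (fun _ => dist_nonneg)
      (fun y => hf.abs_avg_sub_avg_le hf.norm_le x y hr) ?_
    have : Continuous fun y : ℝ => (‖f 0‖ + (totalVar f).toReal) * |y - x| / r := by fun_prop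
    simpa using this.tendsto x
  filter_upwards [h1.eventually_const_lt hvr] with y hy
  exact hy.trans_le (hf.avg_le_maximalFn y hr)

/-- Lower semicontinuity leaves only an upper bound near `x`. For `y < x`, averages of large radius
are close to those at `x`. An average of small radius puts at least half its weight on the side of
the smaller limit `L`, so it is at most about `(L + R) / 2`, which is at most `M f(x)`. -/
theorem IsBV.tendsto_maximalFn_left {f : ℝ → ℂ} (hf : IsBV f) {x L R : ℝ}
    (hL : Tendsto (fun t => ‖f t‖) (𝓝[<] x) (𝓝 L))
    (hR : Tendsto (fun t => ‖f t‖) (𝓝[>] x) (𝓝 R)) (hLR : L ≤ R) :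
    Tendsto (maximalFn f) (𝓝[<] x) (𝓝 (maximalFn f x)) := by
  refine tendsto_order.2 ⟨fun v hv =>
    (hf.lowerSemicontinuous_maximalFn x v hv).filter_mono nhdsWithin_le_nhds, fun v hv => ?_⟩
  obtain ⟨ε, hε, hεv⟩ : ∃ ε > 0, maximalFn f x + 3 * ε = v :=
    ⟨(v - maximalFn f x) / 3, by linarith, by ring⟩
  obtain ⟨a, ha, haL⟩ := mem_nhdsLT_iff_exists_Ioo_subset.1
    (hL (Icc_mem_nhds (sub_lt_self L hε) (lt_add_of_pos_right L hε)))
  obtain ⟨b, hb, hbR⟩ := mem_nhdsGT_iff_exists_Ioo_subset.1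
    (hR (Icc_mem_nhds (sub_lt_self R hε) (lt_add_of_pos_right R hε)))
  simp only [mem_Iio, mem_Ioi] at ha hb
  obtain ⟨δ, hδ, hδa, hδb⟩ : ∃ δ > 0, a ≤ x - 2 * δ ∧ x + 2 * δ ≤ b :=
    ⟨min (x - a) (b - x) / 2, by have := lt_min (sub_pos.2 ha) (sub_pos.2 hb); linarith,
      by linarith [min_le_left (x - a) (b - x)], by linarith [min_le_right (x - a) (b - x)]⟩
  have hl : ∀ t ∈ Ioo (x - 2 * δ) x, L - ε ≤ ‖f t‖ ∧ ‖f t‖ ≤ L + ε := fun t ht =>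
    haL ⟨hδa.trans_lt ht.1, ht.2⟩
  have hr : ∀ t ∈ Ioo x (x + 2 * δ), R - ε ≤ ‖f t‖ ∧ ‖f t‖ ≤ R + ε := fun t ht =>
    hbR ⟨ht.1, ht.2.trans_le hδb⟩
  have hM : (L + R) / 2 - ε ≤ maximalFn f x := by
    refine le_trans ?_ (hf.avg_le_maximalFn x hδ)
    have h1 := hf.le_integral_norm (a := x - δ) (b := x) (by linarith)
      fun t ht => (hl t ⟨by linarith [ht.1], ht.2⟩).1
    have h2 := hf.le_integral_norm (a := x) (b := x + δ) (by linarith)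
      fun t ht => (hr t ⟨ht.1, by linarith [ht.2]⟩).1
    rw [avg, ← intervalIntegral.integral_add_adjacent_intervals
      (hf.intervalIntegrable_norm (x - δ) x) (hf.intervalIntegrable_norm x (x + δ)),
      one_div, le_inv_mul_iff₀ (by positivity)]
    nlinarith
  set C := ‖f 0‖ + (totalVar f).toReal with hC
  have hC0 : 0 ≤ C := (norm_nonneg _).trans (hf.norm_le 0)
  -- The `1` in `C + 1` covers the case `C = 0`.
  have hη : 0 < min δ (ε * δ / (C + 1)) := by positivity
  filter_upwards [Ioo_mem_nhdsLT (sub_lt_self x hη)] with y hy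
  have hy1 : x - y < δ := by linarith [hy.1, min_le_left δ (ε * δ / (C + 1))]
  have hy2 : x - y < ε * δ / (C + 1) := by linarith [hy.1, min_le_right δ (ε * δ / (C + 1))]
  have hyx := hy.2
  refine lt_of_le_of_lt (b := maximalFn f x + 2 * ε) (maximalFn_le fun r hr0 => ?_) (by linarith)
  rcases le_total δ r with hδr | hrδ
  · have h1 := (abs_le.1 (hf.abs_avg_sub_avg_le hf.norm_le x y hr0)).2
    have h2 : C * |y - x| / r ≤ ε := by
      rw [abs_sub_comm, abs_of_pos (by linarith), div_le_iff₀ hr0]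
      rw [lt_div_iff₀ (by positivity)] at hy2
      nlinarith
    linarith [hf.avg_le_maximalFn x hr0]
  · refine le_trans (b := (L + R) / 2 + ε) ?_ (by linarith)
    rw [avg, one_div, inv_mul_le_iff₀ (by positivity)]
    rcases le_total (y + r) x with h | h
    · have h1 := hf.integral_norm_le (a := y - r) (b := y + r) (by linarith)
        fun t ht => (hl t ⟨by linarith [ht.1], by linarith [ht.2]⟩).2
      nlinarith
    · have h1 := hf.integral_norm_le (a := y - r) (b := x) (by linarith)
        fun t ht => (hl t ⟨by linarith [ht.1], ht.2⟩).2
      have h2 := hf.integral_norm_le (a := x) (b := y + r) (by linarith)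
        fun t ht => (hr t ⟨ht.1, by linarith [ht.2]⟩).2
      rw [← intervalIntegral.integral_add_adjacent_intervals
        (hf.intervalIntegrable_norm (y - r) x) (hf.intervalIntegrable_norm x (y + r))]
      nlinarith

/-- At every point the maximal function is continuous from the left or from the right. -/
theorem IsBV.tendsto_maximalFn_left_or_right {f : ℝ → ℂ} (hf : IsBV f) (x : ℝ) :
    Tendsto (maximalFn f) (𝓝[<] x) (𝓝 (maximalFn f x)) ∨
      Tendsto (maximalFn f) (𝓝[>] x) (𝓝 (maximalFn f x)) := by
  have hl := (BoundedVariationOn.tendsto_leftLim hf x).norm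
  have hr := (BoundedVariationOn.tendsto_rightLim hf x).norm
  rcases le_total ‖f.leftLim x‖ ‖f.rightLim x‖ with h | h
  · exact Or.inl (hf.tendsto_maximalFn_left hl hr h)
  · right
    have hl' : Tendsto (fun t : ℝ => -t) (𝓝[<] (-x)) (𝓝[>] x) := by
      simpa using tendsto_neg_nhdsLT (a := -x)
    have hr' : Tendsto (fun t : ℝ => -t) (𝓝[>] (-x)) (𝓝[<] x) := by
      simpa using tendsto_neg_nhdsGT (a := -x)
    have key := hf.comp_neg.tendsto_maximalFn_left (x := -x) (hr.comp hl') (hl.comp hr') h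
    have h3 := key.comp (tendsto_neg_nhdsGT (a := x))
    simpa [Function.comp_def, maximalFn_comp_neg] using h3

theorem IsBV.totalVar_maximalFn_le {f : ℝ → ℂ} (hf : IsBV f) :
    totalVar (maximalFn f) ≤ eVariationOn (maximalFn f) {x | ContinuousAt f x} := by
  have hD : Dense {x | ContinuousAt f x} := Measure.dense_of_ae hf.ae_continuousAt
  refine totalVar_le_eVariationOn fun x ε hε => ?_
  rcases hf.tendsto_maximalFn_left_or_right x with h | h
  · obtain ⟨a, ha, has⟩ := mem_nhdsLT_iff_exists_Ioo_subset.1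
      (inter_mem (h (Metric.ball_mem_nhds _ hε)) (Ioo_mem_nhdsLT (sub_lt_self x hε)))
    obtain ⟨y, hy, hyI⟩ := hD.exists_mem_open isOpen_Ioo (nonempty_Ioo.2 ha)
    obtain ⟨h1, h2⟩ := has hyI
    exact ⟨y, hy, by rw [abs_lt]; constructor <;> linarith [h2.1, h2.2], h1⟩
  · obtain ⟨a, ha, has⟩ := mem_nhdsGT_iff_exists_Ioo_subset.1
      (inter_mem (h (Metric.ball_mem_nhds _ hε)) (Ioo_mem_nhdsGT (lt_add_of_pos_right x hε)))
    obtain ⟨y, hy, hyI⟩ := hD.exists_mem_open isOpen_Ioo (nonempty_Ioo.2 ha)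
    obtain ⟨h1, h2⟩ := has hyI
    exact ⟨y, hy, by rw [abs_lt]; constructor <;> linarith [h2.1, h2.2], h1⟩

/-! ### The sampling grid -/

/-- The nearest integer to `x`, divided by `n` and clamped to `[-n, n]`. -/
noncomputable def grid (n : ℕ) (x : ℝ) : ℝ :=
  max (-(n : ℝ)) (min n ((⌊x + 1 / 2⌋ : ℝ) / n))

theorem grid_mono (n : ℕ) : Monotone (grid n) := by
  intro x y h
  unfold grid
  gcongr

theorem monotone_grid_mul (n : ℕ) : Monotone fun x : ℝ => grid n (n * x) :=
  (grid_mono n).comp (monotone_id.const_mul (Nat.cast_nonneg n))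

theorem abs_floor_div_sub_le {n : ℕ} (hn : 0 < n) (t : ℝ) :
    |(⌊(n : ℝ) * t + 1 / 2⌋ : ℝ) / n - t| ≤ 1 / n := by
  have hn' : (0 : ℝ) < n := by exact_mod_cast hn
  have h1 := Int.floor_le ((n : ℝ) * t + 1 / 2)
  have h2 := Int.lt_floor_add_one ((n : ℝ) * t + 1 / 2)
  rw [div_sub' hn'.ne', abs_div, abs_of_pos hn']
  gcongr
  rw [abs_le]
  constructor <;> linarith

theorem abs_grid_sub_le {n : ℕ} (hn : 0 < n) {t : ℝ} (ht : |t| ≤ n) :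
    |grid n (n * t) - t| ≤ 1 / n := by
  have h := abs_le.1 (abs_floor_div_sub_le hn t)
  have hn' : (0 : ℝ) ≤ 1 / n := by positivity
  have ht := abs_le.1 ht
  rw [abs_le, grid]
  constructor
  · have : t - 1 / n ≤ min (n : ℝ) ((⌊(n : ℝ) * t + 1 / 2⌋ : ℝ) / n) :=
      le_min (by linarith) (by linarith)
    linarith [le_max_right (-(n : ℝ)) (min (n : ℝ) ((⌊(n : ℝ) * t + 1 / 2⌋ : ℝ) / n))]
  · have : max (-(n : ℝ)) (min n ((⌊(n : ℝ) * t + 1 / 2⌋ : ℝ) / n)) ≤ t + 1 / n :=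
      max_le (by linarith) ((min_le_right _ _).trans (by linarith))
    linarith

/-- With `grid_le`, this keeps samples of the tails of `f` in the tails; the loss `1` bounds the
mesh `1/n`. -/
theorem le_grid {n : ℕ} (hn : 0 < n) {K t : ℝ} (hK : K ≤ n) (ht : K ≤ t) :
    K - 1 ≤ grid n (n * t) := by
  have h := abs_le.1 (abs_floor_div_sub_le hn t)
  have hn' : (1 : ℝ) / n ≤ 1 := by
    rw [div_le_one (by exact_mod_cast hn)]; exact_mod_cast hn
  exact le_max_of_le_right (le_min (by linarith) (by linarith))

theorem grid_le {n : ℕ} (hn : 0 < n) {K t : ℝ} (hK : K ≤ n) (ht : t ≤ -K) :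
    grid n (n * t) ≤ -(K - 1) := by
  have h := abs_le.1 (abs_floor_div_sub_le hn t)
  have hn' : (1 : ℝ) / n ≤ 1 := by
    rw [div_le_one (by exact_mod_cast hn)]; exact_mod_cast hn
  exact max_le (by linarith) ((min_le_right _ _).trans (by linarith))

theorem tendsto_grid_mul (t : ℝ) : Tendsto (fun n : ℕ => grid n (n * t)) atTop (𝓝 t) := by
  rw [tendsto_iff_dist_tendsto_zero]
  refine squeeze_zero' (Eventually.of_forall fun _ => dist_nonneg) ?_
    tendsto_one_div_atTop_nhds_zero_nat
  filter_upwards [eventually_gt_atTop 0, tendsto_natCast_atTop_atTop.eventually_ge_atTop |t|]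
    with n hn ht using abs_grid_sub_le hn ht

theorem grid_of_sq_lt {n : ℕ} (hn : 0 < n) {x : ℝ} (hx : (n : ℝ) ^ 2 + 1 < x) :
    grid n x = n ∧ grid n (-x) = -n := by
  have hn' : (0 : ℝ) < n := by exact_mod_cast hn
  constructor
  · have h : (n : ℝ) ≤ (⌊x + 1 / 2⌋ : ℝ) / n := by
      rw [le_div_iff₀ hn']
      linarith [Int.lt_floor_add_one (x + 1 / 2)]
    rw [grid, min_eq_left h, max_eq_right (by linarith)]
  · have h : (⌊-x + 1 / 2⌋ : ℝ) / n ≤ -n := by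
      rw [div_le_iff₀ hn']
      linarith [Int.floor_le (-x + 1 / 2)]
    rw [grid, min_eq_right (by linarith), max_eq_left h]

/-! ### Convergence of the maximal functions at continuity points -/

theorem IsBV.comp_monotone {f : ℝ → ℂ} (hf : IsBV f) {φ : ℝ → ℝ} (hφ : Monotone φ) :
    IsBV fun t => f (φ t) :=
  ne_top_of_le_ne_top hf (totalVar_comp_le f hφ)

theorem IsBV.tendsto_integral_grid {f : ℝ → ℂ} (hf : IsBV f) (a b : ℝ) :
    Tendsto (fun n : ℕ => ∫ t in a..b, |‖f (grid n (n * t))‖ - ‖f t‖|) atTop (𝓝 0) := by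
  have h := intervalIntegral.tendsto_integral_filter_of_dominated_convergence
    (μ := volume) (a := a) (b := b) (l := atTop)
    (F := fun (n : ℕ) t => |‖f (grid n (n * t))‖ - ‖f t‖|) (f := fun _ => (0 : ℝ))
    (fun _ => 2 * (‖f 0‖ + (totalVar f).toReal))
    (Eventually.of_forall fun n => by
      have := ((hf.comp_monotone (monotone_grid_mul n)).intervalIntegrable_norm a b).sub
        (hf.intervalIntegrable_norm a b)
      exact (intervalIntegrable_iff.1 (IntervalIntegrable.abs this)).aestronglyMeasurable)
    (Eventually.of_forall fun n => Eventually.of_forall fun t _ => by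
      rw [Real.norm_eq_abs, abs_abs, two_mul]
      refine (abs_sub _ _).trans (add_le_add ?_ ?_) <;> rw [abs_norm] <;> exact hf.norm_le _)
    intervalIntegrable_const
    (hf.ae_continuousAt.mono fun t ht _ => by
      have := ((ht.tendsto.comp (tendsto_grid_mul t)).norm.sub_const ‖f t‖).abs
      simpa [Function.comp_def] using this)
  simpa using h

theorem abs_norm_sub_norm_le_of_dist_lt {u v w : ℂ} {ε : ℝ} (hu : dist u w < ε)
    (hv : dist v w < ε) : |‖u‖ - ‖v‖| ≤ 2 * ε := by
  refine (abs_norm_sub_norm_le u v).trans ?_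
  rw [← dist_eq_norm]
  linarith [dist_triangle_right u v w]

/-- If the norms of two functions differ by at most `η` on `(x - δ, x + δ)` and outside `(-K, K]`,
then their averages around `x` differ by at most `η` plus an integral over `(-K, K]`. -/
theorem abs_avg_sub_avg_le_of_local {f g : ℝ → ℂ} (hf : IsBV f) (hg : IsBV g)
    {x δ K η : ℝ} (hδ : 0 < δ) (hK : 0 ≤ K) (hη : 0 ≤ η)
    (hx : ∀ t, |t - x| < δ → |‖g t‖ - ‖f t‖| ≤ η)
    (hout : ∀ t, t ∉ Ioc (-K) K → |‖g t‖ - ‖f t‖| ≤ η) {r : ℝ} (hr : 0 < r) :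
    |avg g x r - avg f x r| ≤
      η + (1 / (2 * δ)) * ∫ t in (-K)..K, |‖g t‖ - ‖f t‖| := by
  set E : ℝ → ℝ := fun t => |‖g t‖ - ‖f t‖| with hE
  have hEi : ∀ a b, IntervalIntegrable E volume a b := fun a b =>
    ((hg.intervalIntegrable_norm a b).sub (hf.intervalIntegrable_norm a b)).abs
  have hKK : -K ≤ K := by linarith
  have hI : 0 ≤ ∫ t in (-K)..K, E t :=
    intervalIntegral.integral_nonneg hKK fun t _ => abs_nonneg _
  have hle : x - r ≤ x + r := by linarith
  have h1 : |avg g x r - avg f x r| ≤ (1 / (2 * r)) * ∫ t in (x - r)..(x + r), E t := by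
    rw [avg, avg, ← mul_sub, ← intervalIntegral.integral_sub (hg.intervalIntegrable_norm _ _)
      (hf.intervalIntegrable_norm _ _), abs_mul, abs_of_pos (by positivity : 0 < 1 / (2 * r))]
    gcongr
    exact intervalIntegral.abs_integral_le_integral_abs hle
  refine h1.trans ?_
  -- Small radii see only the neighbourhood of `x`; for large ones the factor `1 / (2 * r)` is at
  -- most `1 / (2 * δ)`, making the bound uniform in `r`.
  rcases le_total r δ with h | h
  · have h2 : ∫ t in (x - r)..(x + r), E t ≤ ∫ _ in (x - r)..(x + r), η :=
      intervalIntegral.integral_mono_on_of_le_Ioo hle (hEi _ _) intervalIntegrable_const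
        fun t ht => hx t (by rw [abs_lt]; constructor <;> linarith [ht.1, ht.2])
    rw [intervalIntegral.integral_const, smul_eq_mul] at h2
    have h3 : (1 / (2 * r)) * ∫ t in (x - r)..(x + r), E t ≤ η := by
      rw [one_div, inv_mul_le_iff₀ (by positivity)]
      linarith
    exact h3.trans (le_add_of_nonneg_right (by positivity))
  · have hEint : Integrable ((Ioc (-K) K).indicator E) :=
      (integrable_indicator_iff measurableSet_Ioc).2
        ((intervalIntegrable_iff_integrableOn_Ioc_of_le hKK).1 (hEi _ _))
    have h2 : ∫ t in (x - r)..(x + r), E t ≤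
        ∫ t in (x - r)..(x + r), (η + (Ioc (-K) K).indicator E t) := by
      refine intervalIntegral.integral_mono_on hle (hEi _ _)
        (intervalIntegrable_const.add hEint.intervalIntegrable) fun t _ => ?_
      by_cases ht : t ∈ Ioc (-K) K
      · rw [indicator_of_mem ht]; linarith
      · rw [indicator_of_notMem ht, add_zero]; exact hout t ht
    rw [intervalIntegral.integral_add intervalIntegrable_const hEint.intervalIntegrable,
      intervalIntegral.integral_const, smul_eq_mul] at h2
    have h3 : ∫ t in (x - r)..(x + r), (Ioc (-K) K).indicator E t ≤ ∫ t in (-K)..K, E t := by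
      rw [intervalIntegral.integral_of_le hle, intervalIntegral.integral_of_le hKK,
        ← integral_indicator (measurableSet_Ioc (a := -K))]
      exact setIntegral_le_integral hEint
        (Eventually.of_forall fun t => indicator_nonneg (fun t _ => abs_nonneg _) t)
    calc (1 / (2 * r)) * ∫ t in (x - r)..(x + r), E t
        ≤ (1 / (2 * r)) * (2 * r * η + ∫ t in (-K)..K, E t) := by
          gcongr
          linarith
      _ = η + (1 / (2 * r)) * ∫ t in (-K)..K, E t := by field_simp
      _ ≤ η + (1 / (2 * δ)) * ∫ t in (-K)..K, E t := by gcongr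

theorem IsBV.tendsto_maximalFn_grid {f : ℝ → ℂ} (hf : IsBV f) {x : ℝ} (hx : ContinuousAt f x) :
    Tendsto (fun n : ℕ => maximalFn (fun t => f (grid n (n * t))) x) atTop
      (𝓝 (maximalFn f x)) := by
  refine Metric.tendsto_nhds.2 fun ε' hε' => ?_
  obtain ⟨ε, hε, rfl⟩ : ∃ ε > 0, 4 * ε = ε' := ⟨ε' / 4, by positivity, by ring⟩
  obtain ⟨δ, hδ, hxδ⟩ := Metric.continuousAt_iff.1 hx ε hε
  obtain ⟨A, hA⟩ := eventually_atTop.1 (Metric.tendsto_nhds.1 hf.tendsto_limPos ε hε)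
  obtain ⟨B, hB⟩ := eventually_atBot.1 (Metric.tendsto_nhds.1 hf.tendsto_limNeg ε hε)
  obtain ⟨K, hK0, hKA, hKB⟩ : ∃ K : ℝ, 0 ≤ K ∧ A ≤ K - 1 ∧ -(K - 1) ≤ B :=
    ⟨max 0 (max (A + 1) (1 - B)), le_max_left _ _,
      by linarith [(le_max_left (A + 1) (1 - B)).trans (le_max_right 0 _)],
      by linarith [(le_max_right (A + 1) (1 - B)).trans (le_max_right 0 _)]⟩
  filter_upwards [eventually_gt_atTop 0,
    tendsto_natCast_atTop_atTop.eventually_ge_atTop (max K (|x| + δ)),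
    tendsto_one_div_atTop_nhds_zero_nat.eventually_lt_const (half_pos hδ),
    (hf.tendsto_integral_grid (-K) K).eventually_lt_const (mul_pos hε hδ)] with n hn hnK hnδ hnI
  have hKn : K ≤ n := (le_max_left _ _).trans hnK
  have hxn : |x| + δ ≤ n := (le_max_right _ _).trans hnK
  have hg := hf.comp_monotone (monotone_grid_mul n)
  refine (abs_maximalFn_sub_le hg hf (ε := 3 * ε) fun r hr => ?_).trans_lt (by linarith)
  -- Points within `δ / 2` of `x` have samples within `δ` of `x`, as `1 / n < δ / 2`. The integral
  -- term contributes the third `ε`.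
  refine (abs_avg_sub_avg_le_of_local (δ := δ / 2) (K := K) (η := 2 * ε) hf hg (half_pos hδ) hK0
    (by positivity) (fun t ht => ?_) (fun t ht => ?_) hr).trans ?_
  · have htn : |t| ≤ n := by
      have := abs_sub_abs_le_abs_sub t x
      linarith
    have h1 := abs_grid_sub_le hn htn
    refine abs_norm_sub_norm_le_of_dist_lt (hxδ ?_) (hxδ ?_) <;> rw [Real.dist_eq]
    · linarith [abs_sub_le (grid n (n * t)) t x]
    · linarith
  · rw [mem_Ioc, not_and_or, not_lt, not_le] at ht
    rcases ht with ht | ht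
    · exact abs_norm_sub_norm_le_of_dist_lt (hB _ ((grid_le hn hKn ht).trans hKB))
        (hB _ (by linarith))
    · exact abs_norm_sub_norm_le_of_dist_lt (hA _ (hKA.trans (le_grid hn hKn ht.le)))
        (hA _ (by linarith))
  · have : 1 / (2 * (δ / 2)) * ∫ t in (-K)..K, |‖f (grid n (n * t))‖ - ‖f t‖| ≤ ε := by
      rw [one_div, inv_mul_le_iff₀ (by positivity)]
      linarith
    linarith

/-! ### Simplicity and limits of the sampled functions -/

theorem IsBV.norm {f : ℝ → ℂ} (hf : IsBV f) : IsBV fun x => (‖f x‖ : ℂ) :=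
  ne_top_of_le_ne_top hf (totalVar_norm_le f)

theorem IsBV.isSimple_grid {f : ℝ → ℂ} (hf : IsBV f) {n : ℕ} (hn : 0 < n) :
    IsSimple fun y => f (grid n y) := by
  refine ⟨hf.comp_monotone (grid_mono n), ⟨f (-n), f n, n ^ 2 + 1, by omega, fun x hx => ?_⟩,
    fun m x hx y hy => ?_⟩
  · obtain ⟨h1, h2⟩ := grid_of_sq_lt hn (x := x) (by exact_mod_cast hx)
    exact ⟨congrArg f h2, congrArg f h1⟩
  · have h : ∀ z ∈ Ico ((m : ℝ) - 1 / 2) ((m : ℝ) + 1 / 2), ⌊z + 1 / 2⌋ = m := fun z hz =>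
      Int.floor_eq_iff.2 ⟨by linarith [hz.1], by linarith [hz.2]⟩
    simp only [grid, h x hx, h y hy]

theorem limPos_grid (f : ℝ → ℂ) {n : ℕ} (hn : 0 < n) : limPos (fun y => f (grid n y)) = f n := by
  refine Tendsto.limUnder_eq (tendsto_const_nhds.congr' ?_)
  filter_upwards [eventually_gt_atTop ((n : ℝ) ^ 2 + 1)] with x hx
  rw [(grid_of_sq_lt hn hx).1]

theorem limNeg_grid (f : ℝ → ℂ) {n : ℕ} (hn : 0 < n) :
    limNeg (fun y => f (grid n y)) = f (-n) := by
  refine Tendsto.limUnder_eq (tendsto_const_nhds.congr' ?_)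
  filter_upwards [eventually_lt_atBot (-((n : ℝ) ^ 2 + 1))] with x hx
  rw [← neg_neg x, (grid_of_sq_lt hn (x := -x) (by linarith)).2]

end CenteredMaximal

/-! ### Passage to the limit -/

open CenteredMaximal in
theorem proposition3
    (h : ∀ g : ℝ → ℂ, IsSimple g → IsNonneg g → VarIneq g)
    (f : ℝ → ℂ) (hf : IsBV f) : VarIneq f := by
  have happrox : ∀ᶠ n : ℕ in atTop,
      totalVar (maximalFn fun t => f (grid n (n * t))) +
        ENNReal.ofReal ((1 / 2) * |‖f n‖ - ‖f (-n)‖|) ≤ totalVar f := by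
    filter_upwards [eventually_gt_atTop 0] with n hn
    have hn' : (0 : ℝ) < n := by exact_mod_cast hn
    have h1 := h (fun y => (‖f (grid n y)‖ : ℂ)) (hf.norm.isSimple_grid hn)
      fun x => ⟨_, norm_nonneg _, rfl⟩
    rw [VarIneq, limPos_grid (fun x => (‖f x‖ : ℂ)) hn, limNeg_grid (fun x => (‖f x‖ : ℂ)) hn,
      maximalFn_norm (fun y => f (grid n y))] at h1
    simp only [Complex.norm_real, norm_norm] at h1
    have h2 : totalVar (maximalFn fun t => f (grid n (n * t))) ≤
        totalVar (maximalFn fun y => f (grid n y)) := by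
      have : (maximalFn fun t => f (grid n (n * t))) =
          fun x => maximalFn (fun y => f (grid n y)) (n * x) :=
        funext fun x => maximalFn_comp_mul_left (fun y => f (grid n y)) hn' x
      rw [this]
      exact totalVar_comp_le _ (monotone_id.const_mul hn'.le)
    exact (add_le_add h2 le_rfl).trans
      (h1.trans ((totalVar_comp_le (fun x => (‖f x‖ : ℂ)) (grid_mono n)).trans
        (totalVar_norm_le f)))
  have hlim : Tendsto (fun n : ℕ => ENNReal.ofReal ((1 / 2) * |‖f n‖ - ‖f (-n)‖|)) atTop
      (𝓝 (ENNReal.ofReal ((1 / 2) * |‖limPos f‖ - ‖limNeg f‖|))) := by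
    have h1 := (hf.tendsto_limPos.comp tendsto_natCast_atTop_atTop).norm
    have h2 := (hf.tendsto_limNeg.comp
      (tendsto_neg_atTop_atBot.comp (tendsto_natCast_atTop_atTop (R := ℝ)))).norm
    exact ENNReal.tendsto_ofReal ((h1.sub h2).abs.const_mul _)
  have hv : ∀ v < totalVar (maximalFn f),
      v + ENNReal.ofReal ((1 / 2) * |‖limPos f‖ - ‖limNeg f‖|) ≤ totalVar f := fun v hv => by
    have h1 := eVariationOn.lowerSemicontinuous_aux
      (F := fun (n : ℕ) => maximalFn fun t => f (grid n (n * t))) (p := atTop)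
      (s := {x | ContinuousAt f x}) (fun x hx => hf.tendsto_maximalFn_grid hx)
      (hv.trans_le hf.totalVar_maximalFn_le)
    refine le_of_tendsto (hlim.const_add v) ?_
    filter_upwards [h1, happrox] with n hn1 hn2
    exact (add_le_add (hn1.le.trans (eVariationOn.mono _ (subset_univ _))) le_rfl).trans hn2
  -- This makes the truncated subtraction of the limit term below exact.
  have hc : ENNReal.ofReal ((1 / 2) * |‖limPos f‖ - ‖limNeg f‖|) ≤ totalVar f :=
    le_of_tendsto hlim (happrox.mono fun n hn => le_add_self.trans hn)
  rw [VarIneq]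
  refine (add_le_add (le_of_forall_lt_imp_le_of_dense fun v hlt => ?_) le_rfl).trans
    (tsub_add_cancel_of_le hc).le
  exact ENNReal.le_sub_of_add_le_right ENNReal.ofReal_ne_top (hv v hlt)
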